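/- Riemann surfaces are connected (second countable, Hausdorff), and $\widehat{\mathbb C}=\mathbb C\cup\{\infty\}$ carries the spherical distance $\chi$, i.e. half of the Euclidean distance in $\mathbb R^3$ between the images of two points under stereographic projection onto the unit sphere. For a Riemann surface $\Sigma$ let $\mathscr M(\Sigma)$ be the set of holomorphic maps $f:\Sigma\to\widehat{\mathbb C}$ (including $f\equiv\infty$), with the topology of uniform convergence on compact subsets with respect to $\chi$. For a property $P$ of holomorphic maps from Riemann surfaces to $\widehat{\mathbb C}$ let $\mathscr P(\Sigma)$ be the set of all $f\in\mathscr M(\Sigma)$ that satisfy $P$ on $\Sigma$. The property $P$ is called a compact property if the following four conditions hold. (P1) If $\phi:\Sigma\to\Sigma'$ is a holomorphic map without ramification points between Riemann surfaces and $f\in\mathscr P(\Sigma')$, then $f\circ\phi\in\mathscr P(\Sigma)$. (P2) If $\Sigma$ is a Riemann surface, $f\in\mathscr M(\Sigma)$, and $f|_\Omega\in\mathscr P(\Omega)$ for every relatively compact domain $\Omega$ of $\Sigma$, then $f\in\mathscr P(\Sigma)$. (P3) For every Riemann surface $\Sigma$, $\mathscr P(\Sigma)$ is a closed subset of $\mathscr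 M(\Sigma)$. (P4) For every Riemann surface $\Sigma$, the family $\mathscr P(\Sigma)$ is normal: every sequence in $\mathscr P(\Sigma)$ has a subsequence that converges, uniformly on compact subsets of $\Sigma$ with respect to $\chi$, to some element of $\mathscr M(\Sigma)$. **Proposition.** Let $L>0$. For a Riemann surface $\Sigma$ and a holomorphic map $f:\Sigma\to\widehat{\mathbb C}$, let $P_L$ be the property that $|f|<L$ on $\Sigma$ or $f$ is constant on $\Sigma$. Then $P_L$ is a compact property. -/

import Mathlib

open Set Filter Topology TopologicalSpace
open scoped Manifold ContDiff OnePoint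

universe u

noncomputable section

/-! ### The extended complex plane as a metric space and as a Riemann surface

The extended plane is Mathlib's one-point compactification `OnePoint ℂ` with its topology. -/

namespace ExtendedPlane

/-- The stereographic projection of the extended plane onto the unit sphere of `ℝ³`,
with `∞ ↦ (0, 0, 1)`. -/
def stereo : OnePoint ℂ → EuclideanSpace ℝ (Fin 3)
  | ∞ => !₂[0, 0, 1]
  | (z : ℂ) => !₂[2 * z.re / (‖z‖ ^ 2 + 1), 2 * z.im / (‖z‖ ^ 2 + 1),
      (‖z‖ ^ 2 - 1) / (‖z‖ ^ 2 + 1)]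

/-- The spherical distance: half of the chordal distance on the unit sphere. -/
def chordalDist (p q : OnePoint ℂ) : ℝ := dist (stereo p) (stereo q) / 2

/-- The inversion `z ↦ 1 / z`, with `0 ↦ ∞` and `∞ ↦ 0`. -/
def inversion : OnePoint ℂ → OnePoint ℂ
  | ∞ => ((0 : ℂ) : OnePoint ℂ)
  | (z : ℂ) => open Classical in if z = 0 then (∞ : OnePoint ℂ) else ((z⁻¹ : ℂ) : OnePoint ℂ)

@[simp] theorem inversion_infty : inversion ∞ = ((0 : ℂ) : OnePoint ℂ) := rfl

@[simp] theorem inversion_zero : inversion ((0 : ℂ) : OnePoint ℂ) = (∞ : OnePoint ℂ) := by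
  change (if (0 : ℂ) = 0 then _ else _) = _
  simp

theorem inversion_coe {z : ℂ} (hz : z ≠ 0) :
    inversion (z : OnePoint ℂ) = ((z⁻¹ : ℂ) : OnePoint ℂ) := by
  change (if z = 0 then _ else _) = _
  simp [hz]

theorem inversion_inversion (p : OnePoint ℂ) : inversion (inversion p) = p := by
  induction p using OnePoint.rec with
  | infty => simp
  | coe z =>
    by_cases hz : z = 0
    · subst hz; simp
    · rw [inversion_coe hz, inversion_coe (inv_ne_zero hz), inv_inv]

theorem continuous_inversion : Continuous inversion := by
  rw [continuous_iff_continuousAt]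
  intro p
  induction p using OnePoint.rec with
  | infty =>
    rw [OnePoint.continuousAt_infty', inversion_infty, coclosedCompact_eq_cocompact,
      ← Metric.cobounded_eq_cocompact]
    have h : Tendsto (fun z : ℂ => ((z⁻¹ : ℂ) : OnePoint ℂ)) (Bornology.cobounded ℂ)
        (𝓝 ((0 : ℂ) : OnePoint ℂ)) :=
      (OnePoint.continuous_coe.tendsto (0 : ℂ)).comp tendsto_inv₀_cobounded
    refine h.congr' ?_
    have h0 : ∀ᶠ z : ℂ in Bornology.cobounded ℂ, z ≠ 0 := by
      have h1 : Bornology.IsBounded ({0} : Set ℂ) := Bornology.isBounded_singleton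
      exact h1
    filter_upwards [h0] with z hz
    exact (inversion_coe hz).symm
  | coe z =>
    rw [OnePoint.continuousAt_coe]
    by_cases hz : z = 0
    · subst hz
      rw [continuousAt_iff_punctured_nhds]
      have h : Tendsto (fun z : ℂ => ((z⁻¹ : ℂ) : OnePoint ℂ)) (𝓝[≠] 0) (𝓝 ∞) := by
        refine Tendsto.comp ?_ tendsto_inv₀_nhdsNE_zero
        have := OnePoint.tendsto_coe_infty (X := ℂ)
        rwa [coclosedCompact_eq_cocompact, ← Metric.cobounded_eq_cocompact] at this
      simp only [Function.comp_apply, inversion_zero]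
      refine h.congr' ?_
      filter_upwards [self_mem_nhdsWithin] with z hz
      exact (inversion_coe hz).symm
    · have h : ContinuousAt (fun z : ℂ => ((z⁻¹ : ℂ) : OnePoint ℂ)) z :=
        OnePoint.continuous_coe.continuousAt.comp (continuousAt_inv₀ hz)
      refine h.congr ?_
      filter_upwards [isOpen_ne.mem_nhds hz] with w hw
      exact (inversion_coe hw).symm

/-- The inversion as a homeomorphism. -/
def inversionHomeo : OnePoint ℂ ≃ₜ OnePoint ℂ where
  toFun := inversion
  invFun := inversion
  left_inv := inversion_inversion
  right_inv := inversion_inversion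
  continuous_toFun := continuous_inversion
  continuous_invFun := continuous_inversion

theorem stereo_coe (z : ℂ) : stereo (z : OnePoint ℂ) =
    !₂[2 * z.re / (‖z‖ ^ 2 + 1), 2 * z.im / (‖z‖ ^ 2 + 1), (‖z‖ ^ 2 - 1) / (‖z‖ ^ 2 + 1)] := rfl

theorem stereo_infty : stereo ∞ = !₂[0, 0, 1] := rfl

theorem stereo_injective : Function.Injective stereo := by
  intro p q h
  have h0 := congrArg (fun v => v 0) h
  have h1 := congrArg (fun v => v 1) h
  have h2 := congrArg (fun v => v 2) h
  induction p using OnePoint.rec with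
  | infty =>
    induction q using OnePoint.rec with
    | infty => rfl
    | coe w =>
      simp [stereo_coe, stereo_infty] at h2
      have : ‖w‖ ^ 2 + 1 ≠ 0 := by positivity
      rw [eq_div_iff this] at h2
      linarith
  | coe z =>
    have hz : ‖z‖ ^ 2 + 1 ≠ 0 := by positivity
    induction q using OnePoint.rec with
    | infty =>
      simp [stereo_coe, stereo_infty] at h2
      rw [div_eq_iff hz] at h2
      linarith
    | coe w =>
      have hw : ‖w‖ ^ 2 + 1 ≠ 0 := by positivity
      simp [stereo_coe] at h0 h1 h2
      have e : ‖z‖ ^ 2 = ‖w‖ ^ 2 := by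
        rw [div_eq_div_iff hz hw] at h2
        linarith
      rw [e, div_left_inj' hw] at h0 h1
      congr 1
      apply Complex.ext <;> linarith

theorem continuous_stereo_coe : Continuous fun z : ℂ => stereo (z : OnePoint ℂ) := by
  simp only [stereo_coe]
  have hz : ∀ z : ℂ, ‖z‖ ^ 2 + 1 ≠ 0 := fun z => by positivity
  refine (PiLp.continuous_toLp 2 _).comp (continuous_pi fun i => ?_)
  fin_cases i
  · exact Continuous.div (by fun_prop) (by fun_prop) hz
  · exact Continuous.div (by fun_prop) (by fun_prop) hz
  · exact Continuous.div (by fun_prop) (by fun_prop) hz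

/-- Inversion corresponds to a rotation of the sphere. -/
theorem stereo_inversion (p : OnePoint ℂ) :
    stereo p = !₂[stereo (inversion p) 0, -stereo (inversion p) 1, -stereo (inversion p) 2] := by
  induction p using OnePoint.rec with
  | infty => ext i; fin_cases i <;> simp [stereo_coe, stereo_infty]
  | coe z =>
    by_cases hz : z = 0
    · subst hz
      ext i; fin_cases i <;> simp [stereo_coe, stereo_infty]
    · have h1 : ‖z‖ ≠ 0 := norm_ne_zero_iff.mpr hz
      have h2 : ‖z‖ ^ 2 + 1 ≠ 0 := by positivity
      have h3 : 1 + ‖z‖ ^ 2 ≠ 0 := by positivity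
      rw [inversion_coe hz]
      ext i
      fin_cases i
      · simp [stereo_coe, Complex.inv_re, Complex.normSq_eq_norm_sq]
        field_simp
        ring
      · simp [stereo_coe, Complex.inv_im, Complex.normSq_eq_norm_sq]
        field_simp
        ring
      · simp [stereo_coe]
        field_simp
        ring

theorem continuous_stereo : Continuous stereo := by
  have key : ∀ z : ℂ, ContinuousAt stereo (z : OnePoint ℂ) := fun z =>
    OnePoint.continuousAt_coe.mpr continuous_stereo_coe.continuousAt
  rw [continuous_iff_continuousAt]
  intro p
  induction p using OnePoint.rec with
  | coe z => exact key z
  | infty =>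
    have h : ContinuousAt (fun p => stereo (inversion p)) ∞ :=
      ContinuousAt.comp (f := inversion) (g := stereo) (x := (∞ : OnePoint ℂ))
        (key 0) continuous_inversion.continuousAt
    have h' := fun i : Fin 3 => ContinuousAt.comp (f := fun p => stereo (inversion p))
      (g := fun v : EuclideanSpace ℝ (Fin 3) => v i) (x := ∞)
      (Continuous.continuousAt (by fun_prop)) h
    have e : stereo = fun p => !₂[stereo (inversion p) 0, -stereo (inversion p) 1,
      -stereo (inversion p) 2] := funext stereo_inversion
    rw [e]
    refine (PiLp.continuous_toLp 2 _).continuousAt.comp (continuousAt_pi.mpr fun i => ?_)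
    fin_cases i
    · exact h' 0
    · exact (h' 1).neg
    · exact (h' 2).neg

theorem isEmbedding_stereo : IsEmbedding stereo :=
  (continuous_stereo.isClosedEmbedding stereo_injective).isEmbedding

/-- The metric space of the spherical distance, before identifying its topology. -/
abbrev chordalMetricAux : MetricSpace (OnePoint ℂ) where
  dist := chordalDist
  dist_self p := by simp [chordalDist]
  dist_comm p q := by simp [chordalDist, dist_comm]
  dist_triangle p q r := by
    have := dist_triangle (stereo p) (stereo q) (stereo r)
    simp only [chordalDist]
    linarith
  eq_of_dist_eq_zero {p q} h := by
    apply stereo_injective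
    apply dist_eq_zero.mp
    change dist (stereo p) (stereo q) / 2 = 0 at h
    linarith

theorem chordal_topology :
    (inferInstance : TopologicalSpace (OnePoint ℂ)) =
      chordalMetricAux.toUniformSpace.toTopologicalSpace := by
  rw [isEmbedding_stereo.eq_induced]
  refine TopologicalSpace.ext_nhds fun p => ?_
  rw [nhds_induced]
  refine ((Metric.nhds_basis_ball (x := stereo p)).comap stereo).eq_of_same_basis ?_
  refine (@Metric.nhds_basis_ball _ chordalMetricAux.toPseudoMetricSpace p).to_hasBasis ?_ ?_
  · intro ε hε
    refine ⟨2 * ε, by positivity, fun q hq => ?_⟩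
    have : dist (stereo q) (stereo p) < 2 * ε := hq
    change dist (stereo q) (stereo p) / 2 < ε
    linarith
  · intro ε hε
    refine ⟨ε / 2, by positivity, fun q hq => ?_⟩
    have : dist (stereo q) (stereo p) / 2 < ε / 2 := hq
    change dist (stereo q) (stereo p) < ε
    linarith

/-- The extended plane with the spherical distance; the topology is that of the one-point
compactification. -/
instance instMetricSpace : MetricSpace (OnePoint ℂ) :=
  chordalMetricAux.replaceTopology chordal_topology

/-- The chart `z ↦ z` on the finite plane. -/
def chartFinite : OpenPartialHomeomorph (OnePoint ℂ) ℂ :=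
  (OnePoint.isOpenEmbedding_coe.toOpenPartialHomeomorph ((↑) : ℂ → OnePoint ℂ)).symm

/-- The chart `z ↦ 1 / z` on the complement of `0`. -/
def chartInfty : OpenPartialHomeomorph (OnePoint ℂ) ℂ :=
  inversionHomeo.transOpenPartialHomeomorph chartFinite

instance instChartedSpace : ChartedSpace ℂ (OnePoint ℂ) where
  atlas := {chartFinite, chartInfty}
  chartAt
    | ∞ => chartInfty
    | (_ : ℂ) => chartFinite
  mem_chart_source p := by
    induction p using OnePoint.rec with
    | infty => exact ⟨0, mem_univ _, rfl⟩
    | coe z => exact ⟨z, mem_univ _, rfl⟩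
  chart_mem_atlas p := by
    induction p using OnePoint.rec with
    | infty => exact Or.inr rfl
    | coe z => exact Or.inl rfl

theorem chartFinite_coe (z : ℂ) : chartFinite (z : OnePoint ℂ) = z :=
  (OnePoint.isOpenEmbedding_coe.toOpenPartialHomeomorph
    ((↑) : ℂ → OnePoint ℂ)).left_inv (mem_univ z)

theorem infty_notMem_chartFinite : (∞ : OnePoint ℂ) ∉ chartFinite.source := by
  rintro ⟨z, -, hz⟩
  exact OnePoint.coe_ne_infty z hz

instance instIsManifold : IsManifold 𝓘(ℂ) ω (OnePoint ℂ) := by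
  have symm_coe : ∀ z : ℂ, chartFinite.symm z = (z : OnePoint ℂ) := fun _ => rfl
  have key : ∀ (s : Set ℂ) (g : ℂ → ℂ), (∀ z ∈ s, z ≠ 0 ∧ g z = z⁻¹) → ContDiffOn ℂ ω g s := by
    intro s g h
    refine ContDiffOn.congr (f := fun z : ℂ => z⁻¹) ?_ (fun z hz => (h z hz).2)
    exact contDiffOn_id.inv (fun z hz => (h z hz).1)
  refine isManifold_of_contDiffOn 𝓘(ℂ) ω (OnePoint ℂ) ?_
  rintro e e' (rfl | rfl) (rfl | rfl)
  · refine contDiffOn_id.congr fun z hz => ?_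
    exact chartFinite_coe z
  · refine key _ _ fun z hz => ?_
    have hz' : inversion (z : OnePoint ℂ) ∈ chartFinite.source := by
      simpa [chartInfty, inversionHomeo, symm_coe] using hz.1.2
    have h0 : z ≠ 0 := by
      rintro rfl
      exact infty_notMem_chartFinite (by simpa using hz')
    refine ⟨h0, ?_⟩
    change chartFinite (inversion (z : OnePoint ℂ)) = z⁻¹
    rw [inversion_coe h0, chartFinite_coe]
  · refine key _ _ fun z hz => ?_
    have hz' : inversion (z : OnePoint ℂ) ∈ chartFinite.source := by
      have := hz.1.2
      exact this
    have h0 : z ≠ 0 := by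
      rintro rfl
      exact infty_notMem_chartFinite (by simpa using hz')
    refine ⟨h0, ?_⟩
    change chartFinite (inversion (z : OnePoint ℂ)) = z⁻¹
    rw [inversion_coe h0, chartFinite_coe]
  · refine contDiffOn_id.congr fun z hz => ?_
    change chartFinite (inversion (inversion (z : OnePoint ℂ))) = z
    rw [inversion_inversion, chartFinite_coe]

end ExtendedPlane

/-! ### Riemann surfaces and holomorphic maps into the extended plane -/

/-- A (connected) Riemann surface: a connected Hausdorff second countable complex manifold of
dimension one. -/
class IsRiemannSurface (S : Type u) [TopologicalSpace S] [ChartedSpace ℂ S] : Prop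
    extends ConnectedSpace S, T2Space S, SecondCountableTopology S, IsManifold 𝓘(ℂ) ω S

/-- A domain (nonempty connected open subset) of a Riemann surface is a Riemann surface. -/
theorem IsRiemannSurface.of_domain {S : Type u} [TopologicalSpace S] [ChartedSpace ℂ S]
    [IsRiemannSurface S] (U : Opens S) (hU : IsConnected (U : Set S)) : IsRiemannSurface U where
  toConnectedSpace := isConnected_iff_connectedSpace.mp hU
  toT2Space := inferInstance
  toSecondCountableTopology := inferInstance
  toIsManifold := inferInstance

/-- The set `𝓜(S)` of holomorphic maps from `S` to the extended complex plane (including the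
constant map `∞`). -/
def HolMap (S : Type u) [TopologicalSpace S] [ChartedSpace ℂ S] : Type u :=
  {f : S → OnePoint ℂ // MDifferentiable 𝓘(ℂ) 𝓘(ℂ) f}

namespace HolMap

variable {S : Type u} [TopologicalSpace S] [ChartedSpace ℂ S]

instance : CoeFun (HolMap S) fun _ => S → OnePoint ℂ := ⟨Subtype.val⟩

/-- The underlying continuous map. -/
def toContinuousMap (f : HolMap S) : C(S, OnePoint ℂ) := ⟨f.1, f.2.continuous⟩

/-- The topology of uniform convergence on compact subsets (that is, the compact-open
topology). -/
instance : TopologicalSpace (HolMap S) :=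
  TopologicalSpace.induced toContinuousMap inferInstance

/-- Precomposition with a holomorphic map. -/
def comp {T : Type u} [TopologicalSpace T] [ChartedSpace ℂ T] (f : HolMap T) (φ : S → T)
    (hφ : MDifferentiable 𝓘(ℂ) 𝓘(ℂ) φ) : HolMap S :=
  ⟨fun p => f (φ p), f.2.comp hφ⟩

/-- Restriction to an open subset. -/
def restrict (f : HolMap S) (U : Opens S) : HolMap U :=
  f.comp (Subtype.val : U → S)
    ((contMDiff_subtype_val (I := 𝓘(ℂ)) (n := 1) (U := U)).mdifferentiable (by simp))

/-- A family of holomorphic maps into the extended plane is normal if every sequence in it has a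
subsequence that converges uniformly on compact subsets with respect to the spherical distance. -/
def IsNormalFamily (F : Set (HolMap S)) : Prop :=
  ∀ f : ℕ → HolMap S, (∀ n, f n ∈ F) →
    ∃ k : ℕ → ℕ, StrictMono k ∧ ∃ g : HolMap S, ∀ K : Set S, IsCompact K →
      ∀ ε > 0, ∃ N, ∀ n ≥ N, ∀ p ∈ K, ExtendedPlane.chordalDist (f (k n) p) (g p) < ε

end HolMap

/-! ### Properties of holomorphic maps into the extended plane -/

/-- A property `P` of holomorphic maps from Riemann surfaces to the extended plane; `P S` is the
set `𝓟(S)` of all maps in `𝓜(S)` which have the property. -/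
def HolMapProperty : Type (u + 1) :=
  ∀ (S : Type u) [TopologicalSpace S] [ChartedSpace ℂ S] [IsRiemannSurface S], Set (HolMap S)

/-- Closed properties: invariance under precomposition with unramified holomorphic maps,
detection on relatively compact domains, and closedness in `𝓜(S)`. -/
structure IsClosedProperty (P : HolMapProperty.{u}) : Prop where
  comp_mem : ∀ (S T : Type u) [TopologicalSpace S] [ChartedSpace ℂ S] [IsRiemannSurface S]
    [TopologicalSpace T] [ChartedSpace ℂ T] [IsRiemannSurface T]
    (φ : S → T) (hφ : MDifferentiable 𝓘(ℂ) 𝓘(ℂ) φ),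
    (∀ p, mfderiv 𝓘(ℂ) 𝓘(ℂ) φ p ≠ 0) → ∀ f ∈ P T, f.comp φ hφ ∈ P S
  mem_of_restrict : ∀ (S : Type u) [TopologicalSpace S] [ChartedSpace ℂ S] [IsRiemannSurface S]
    (f : HolMap S),
    (∀ (U : Opens S) (hU : IsConnected (U : Set S)), IsCompact (closure (U : Set S)) →
      haveI := IsRiemannSurface.of_domain U hU
      f.restrict U ∈ P U) → f ∈ P S
  isClosed : ∀ (S : Type u) [TopologicalSpace S] [ChartedSpace ℂ S] [IsRiemannSurface S],
    IsClosed (P S)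

/-- Compact properties: closed properties for which all families `𝓟(S)` are normal. -/
structure IsCompactProperty (P : HolMapProperty.{u}) : Prop extends IsClosedProperty P where
  normal : ∀ (S : Type u) [TopologicalSpace S] [ChartedSpace ℂ S] [IsRiemannSurface S],
    HolMap.IsNormalFamily (P S)

/-- The property `P_L`: `|f| < L` on `S` (in particular `f` has no poles), or `f` is constant. -/
def boundedOrConstant (L : ℝ) : HolMapProperty.{u} := fun S _ _ _ =>
  {f : HolMap S | (∀ p : S, ∃ z : ℂ, f p = (z : OnePoint ℂ) ∧ ‖z‖ < L) ∨
    ∃ c : OnePoint ℂ, ∀ p : S, f p = c}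

end

/-!
Write `𝓑` for the maps with `|f| ≤ L` and `𝓒` for the constant maps.

Being bounded by `L` or constant passes to compositions. It is detected on relatively compact
domains because any three points lie in one (`exists_relativelyCompact_domain`): if `f p ≠ f q`,
then `f` is not constant on a domain containing `p`, `q` and `r`, so `|f r| < L`.

For closedness, `𝓑` and `𝓒` are both closed under pointwise limits, and by the maximum modulus
principle a map in `𝓑` satisfies `|f| < L` or is constant (`HolMap.norm_lt_or_const_of_norm_le`).
So the family in question is equal to the closed set `𝓑 ∪ 𝓒`.

For normality, `𝓒` is normal since the extended plane is compact, and `𝓑` is normal by Montel's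
theorem (`exists_subseq_tendsto_of_norm_le`), which follows from the Schwarz lemma in charts and the
Arzelà–Ascoli theorem. A union of two normal families is normal.
-/

/-! ### The Arzelà–Ascoli theorem for bounded maps into a proper space -/

namespace ContinuousMap

variable {X E : Type*} [TopologicalSpace X] [MetricSpace E] [ProperSpace E]

/-- An equicontinuous, pointwise bounded family of continuous maps is relatively compact for the
compact-open topology. The compact set is the closure for pointwise convergence: it is compact by
Tychonoff's theorem, and it consists of continuous maps because the closure of an equicontinuous
family is equicontinuous. -/
theorem exists_isCompact_superset_of_equicontinuous (K : Set C(X, E)) (x₀ : E) (R : ℝ)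
    (hR : ∀ g ∈ K, ∀ p, g p ∈ Metric.closedBall x₀ R)
    (hK : Equicontinuous fun g : K => ((g : C(X, E)) : X → E)) :
    ∃ K' : Set C(X, E), K ⊆ K' ∧ IsCompact K' := by
  set A : Set (X → E) := (fun g : C(X, E) => (g : X → E)) '' K with hA
  have hAe : A.Equicontinuous := by
    intro p U hU
    filter_upwards [hK p U hU] with q hq
    rintro ⟨_, g, hg, rfl⟩
    exact hq ⟨g, hg⟩
  have hcl : (closure A).Equicontinuous := hAe.closure
  refine ⟨{g | (g : X → E) ∈ closure A}, fun g hg => subset_closure ⟨g, hg, rfl⟩, ?_⟩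
  refine ArzelaAscoli.isCompact_of_equicontinuous _ ?_ ?_
  · have himage : ContinuousMap.toFun '' {g : C(X, E) | (g : X → E) ∈ closure A} = closure A := by
      ext h
      constructor
      · rintro ⟨g, hg, rfl⟩
        exact hg
      · intro hh
        exact ⟨⟨h, hcl.continuous ⟨h, hh⟩⟩, hh, rfl⟩
    rw [himage]
    have hcpt : IsCompact (Set.univ.pi fun _ : X => Metric.closedBall x₀ R) :=
      isCompact_univ_pi fun _ => isCompact_closedBall _ _
    refine hcpt.closure_of_subset ?_
    rintro _ ⟨g, hg, rfl⟩ p -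
    exact hR g hg p
  · intro p U hU
    filter_upwards [hcl p U hU] with q hq
    rintro ⟨g, hg⟩
    exact hq ⟨g, hg⟩

end ContinuousMap

/-! ### Montel's theorem for bounded holomorphic functions -/

section ComplexCurve

variable {S : Type u} [TopologicalSpace S] [ChartedSpace ℂ S]

theorem MDifferentiable.differentiableOn_chartAt_symm [IsManifold 𝓘(ℂ) ω S] {g : S → ℂ}
    (hg : MDifferentiable 𝓘(ℂ) 𝓘(ℂ) g) (p : S) :
    DifferentiableOn ℂ (g ∘ (chartAt ℂ p).symm) (chartAt ℂ p).target := by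
  have : IsManifold 𝓘(ℂ) 1 S := .of_le (n := ω) le_top
  rw [← mdifferentiableOn_iff_differentiableOn]
  exact hg.comp_mdifferentiableOn
    (mdifferentiableOn_atlas_symm (I := 𝓘(ℂ)) (chart_mem_atlas ℂ p))

theorem mdifferentiable_of_differentiableOn_chartAt_symm {g : S → ℂ} (hc : Continuous g)
    (hg : ∀ p : S, DifferentiableOn ℂ (g ∘ (chartAt ℂ p).symm) (chartAt ℂ p).target) :
    MDifferentiable 𝓘(ℂ) 𝓘(ℂ) g := by
  intro p
  rw [mdifferentiableAt_iff]
  refine ⟨hc.continuousAt, ?_⟩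
  have h := (hg p).differentiableAt ((chartAt ℂ p).open_target.mem_nhds (mem_chart_target ℂ p))
  simpa [mfld_simps, differentiableWithinAt_univ] using! h

/-- Uniformly bounded holomorphic functions are equicontinuous: by the Schwarz lemma on a disc of
radius `r` about `p` in a chart, they all satisfy a Lipschitz estimate at `p` with constant
`2 * L / r`. -/
theorem equicontinuous_of_mdifferentiable_of_norm_le [IsManifold 𝓘(ℂ) ω S] {ι : Type*}
    {F : ι → S → ℂ} {L : ℝ} (hF : ∀ i, MDifferentiable 𝓘(ℂ) 𝓘(ℂ) (F i))
    (hL : ∀ i p, ‖F i p‖ ≤ L) : Equicontinuous F := by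
  intro p
  set φ := chartAt ℂ p with hφ
  obtain ⟨r, hr, hball⟩ := Metric.isOpen_iff.mp φ.open_target (φ p) (mem_chart_target ℂ p)
  have hcont : ContinuousAt φ p := φ.continuousAt (mem_chart_source ℂ p)
  refine Metric.equicontinuousAt_of_continuity_modulus
    (fun q => 2 * L / r * dist (φ q) (φ p)) ?_ F ?_
  · have h := (hcont.dist (continuousAt_const (y := φ p))).const_mul (2 * L / r)
    simpa [ContinuousAt] using h
  · filter_upwards [φ.open_source.mem_nhds (mem_chart_source ℂ p),
      hcont (Metric.ball_mem_nhds _ hr)] with q hq hqr i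
    have hd := ((hF i).differentiableOn_chartAt_symm p).mono hball
    have hp : (F i ∘ φ.symm) (φ p) = F i p := by simp [hφ]
    have hm : MapsTo (F i ∘ φ.symm) (Metric.ball (φ p) r)
        (Metric.closedBall ((F i ∘ φ.symm) (φ p)) (2 * L)) := by
      intro w _
      rw [hp, Metric.mem_closedBall, dist_eq_norm]
      have := norm_sub_le (F i (φ.symm w)) (F i p)
      have := hL i (φ.symm w)
      have := hL i p
      simp only [Function.comp_apply]
      linarith
    have h := Complex.dist_le_div_mul_dist_of_mapsTo_ball hd hm hqr
    rw [hp, Function.comp_apply, φ.left_inv hq] at h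
    rwa [dist_comm]

/-- Weierstrass' convergence theorem on a complex curve. -/
theorem mdifferentiable_of_tendsto [IsManifold 𝓘(ℂ) ω S] {G : ℕ → C(S, ℂ)} {g : C(S, ℂ)}
    (hG : ∀ n, MDifferentiable 𝓘(ℂ) 𝓘(ℂ) (G n)) (h : Tendsto G atTop (𝓝 g)) :
    MDifferentiable 𝓘(ℂ) 𝓘(ℂ) g := by
  refine mdifferentiable_of_differentiableOn_chartAt_symm g.continuous fun p => ?_
  have : LocallyCompactSpace S := ChartedSpace.locallyCompactSpace ℂ S
  have hu := (ContinuousMap.tendsto_iff_tendstoLocallyUniformly.mp h)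
  have hu' := (hu.tendstoLocallyUniformlyOn (s := univ)).comp (chartAt ℂ p).symm
    (mapsTo_univ _ _) (chartAt ℂ p).continuousOn_symm
  exact hu'.differentiableOn (.of_forall fun n => (hG n).differentiableOn_chartAt_symm p)
    (chartAt ℂ p).open_target

/-- **Montel's theorem** on a Riemann surface: a uniformly bounded sequence of holomorphic functions
has a subsequence that converges locally uniformly to a holomorphic function. -/
theorem exists_subseq_tendsto_of_norm_le [IsRiemannSurface S] {G : ℕ → C(S, ℂ)} {L : ℝ}
    (hG : ∀ n, MDifferentiable 𝓘(ℂ) 𝓘(ℂ) (G n)) (hL : ∀ n p, ‖G n p‖ ≤ L) :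
    ∃ k : ℕ → ℕ, StrictMono k ∧ ∃ g : C(S, ℂ), MDifferentiable 𝓘(ℂ) 𝓘(ℂ) g ∧
      Tendsto (G ∘ k) atTop (𝓝 g) := by
  have : LocallyCompactSpace S := ChartedSpace.locallyCompactSpace ℂ S
  obtain ⟨K, hGK, hK⟩ := ContinuousMap.exists_isCompact_superset_of_equicontinuous (range G) 0 L
    (by rintro _ ⟨n, rfl⟩ p; simpa using hL n p)
    (equicontinuous_of_mdifferentiable_of_norm_le (L := L)
      (by rintro ⟨_, n, rfl⟩; exact hG n) (by rintro ⟨_, n, rfl⟩; exact hL n))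
  -- `S` is locally compact and σ-compact, so `C(S, ℂ)` has a countably generated uniformity and
  -- compact subsets are sequentially compact.
  obtain ⟨g, -, k, hk, hlim⟩ := hK.isSeqCompact (fun n => hGK (mem_range_self n))
  exact ⟨k, hk, g, mdifferentiable_of_tendsto (fun n => hG (k n)) hlim, hlim⟩

end ComplexCurve

/-! ### The finite plane inside the extended plane -/

namespace ExtendedPlane

theorem mdifferentiable_coe : MDifferentiable 𝓘(ℂ) 𝓘(ℂ) ((↑) : ℂ → OnePoint ℂ) := by
  have : IsManifold 𝓘(ℂ) 1 (OnePoint ℂ) := .of_le (n := ω) le_top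
  have h := mdifferentiableOn_atlas_symm (I := 𝓘(ℂ)) (e := chartFinite)
    (show chartFinite ∈ atlas ℂ (OnePoint ℂ) from Or.inl rfl)
  exact mdifferentiableOn_univ.mp h

theorem mdifferentiableOn_chartFinite :
    MDifferentiableOn 𝓘(ℂ) 𝓘(ℂ) chartFinite chartFinite.source := by
  have : IsManifold 𝓘(ℂ) 1 (OnePoint ℂ) := .of_le (n := ω) le_top
  exact mdifferentiableOn_atlas (I := 𝓘(ℂ)) (show chartFinite ∈ atlas ℂ (OnePoint ℂ) from Or.inl rfl)

/-- The metric of the spherical distance induces the topology of `OnePoint ℂ`, so convergence in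
the compact-open topology is uniform convergence on compact sets for `chordalDist`. -/
theorem exists_forall_chordalDist_lt_of_tendsto {X : Type*} [TopologicalSpace X]
    {F : ℕ → C(X, OnePoint ℂ)} {g : C(X, OnePoint ℂ)}
    (h : Tendsto F atTop (𝓝 g)) {K : Set X} (hK : IsCompact K) {ε : ℝ} (hε : 0 < ε) :
    ∃ N, ∀ n ≥ N, ∀ p ∈ K, chordalDist (F n p) (g p) < ε := by
  have hu := ContinuousMap.tendsto_iff_forall_isCompact_tendstoUniformlyOn.mp h K hK
  obtain ⟨N, hN⟩ := eventually_atTop.mp (Metric.tendstoUniformlyOn_iff.mp hu ε hε)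
  refine ⟨N, fun n hn p hp => ?_⟩
  have h' : dist (F n p) (g p) < ε := by
    rw [dist_comm]
    exact hN n hn p hp
  exact h'

end ExtendedPlane

/-! ### Closed and normal families of holomorphic maps -/

namespace HolMap

open ExtendedPlane

variable {S : Type u} [TopologicalSpace S] [ChartedSpace ℂ S]

/-- A holomorphic map into the extended plane without poles is a holomorphic function. -/
theorem exists_eq_coe (f : HolMap S) (hf : ∀ p, ∃ z : ℂ, f p = (z : OnePoint ℂ)) :
    ∃ g : S → ℂ, MDifferentiable 𝓘(ℂ) 𝓘(ℂ) g ∧ ∀ p, f p = (g p : OnePoint ℂ) := by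
  choose g hg using hf
  refine ⟨g, ?_, hg⟩
  have h : MDifferentiable 𝓘(ℂ) 𝓘(ℂ) (fun p => chartFinite (f p)) := by
    rw [← mdifferentiableOn_univ]
    refine mdifferentiableOn_chartFinite.comp f.2.mdifferentiableOn fun p _ => ?_
    exact ⟨g p, mem_univ _, (hg p).symm⟩
  have e : (fun p => chartFinite (f p)) = g := by
    funext p
    rw [hg p, chartFinite_coe]
  rwa [e] at h

theorem continuous_eval (p : S) : Continuous fun f : HolMap S => f p :=
  (continuous_eval_const (F := C(S, OnePoint ℂ)) p).comp
    (continuous_induced_dom (f := toContinuousMap))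

/-- The maximum modulus principle: a map bounded by `L` that attains modulus `L` is constant. -/
theorem norm_lt_or_const_of_norm_le [IsRiemannSurface S] {L : ℝ} (f : HolMap S)
    (hf : ∀ p, ∃ z : ℂ, f p = (z : OnePoint ℂ) ∧ ‖z‖ ≤ L) :
    (∀ p, ∃ z : ℂ, f p = (z : OnePoint ℂ) ∧ ‖z‖ < L) ∨ ∃ c, ∀ p, f p = c := by
  obtain ⟨g, hg, hfg⟩ := f.exists_eq_coe fun p => (hf p).imp fun _ h => h.1
  have hgL : ∀ p, ‖g p‖ ≤ L := fun p => by
    obtain ⟨z, hz, hzL⟩ := hf p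
    rw [hfg p, OnePoint.coe_eq_coe] at hz
    rwa [hz]
  by_cases h : ∃ p, ‖g p‖ = L
  · obtain ⟨p, hp⟩ := h
    right
    refine ⟨f p, fun q => ?_⟩
    have : IsManifold 𝓘(ℂ) 1 S := .of_le (n := ω) le_top
    have := hg.mdifferentiableOn.eqOn_of_isPreconnected_of_isMaxOn_norm isPreconnected_univ
      isOpen_univ (mem_univ p) (fun q _ => by simpa [hp] using hgL q) (mem_univ q)
    rw [hfg, hfg, this, Function.const_apply]
  · push Not at h
    exact Or.inl fun p => ⟨g p, hfg p, (hgL p).lt_of_ne (h p)⟩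

theorem isClosed_setOf_const : IsClosed {f : HolMap S | ∃ c : OnePoint ℂ, ∀ p, f p = c} := by
  have e : {f : HolMap S | ∃ c : OnePoint ℂ, ∀ p, f p = c} =
      {f : HolMap S | ∀ p q, f p = f q} := by
    ext f
    refine ⟨fun ⟨c, hc⟩ p q => (hc p).trans (hc q).symm, fun h => ?_⟩
    rcases isEmpty_or_nonempty S with hS | ⟨⟨p⟩⟩
    · exact ⟨∞, fun p => hS.elim p⟩
    · exact ⟨f p, fun q => h q p⟩
  rw [e]
  simp only [ofPred_forall]
  exact isClosed_iInter fun p => isClosed_iInter fun q =>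
    isClosed_eq (continuous_eval p) (continuous_eval q)

theorem isClosed_setOf_norm_le (L : ℝ) :
    IsClosed {f : HolMap S | ∀ p, ∃ z : ℂ, f p = (z : OnePoint ℂ) ∧ ‖z‖ ≤ L} := by
  have hc : IsClosed (((↑) : ℂ → OnePoint ℂ) '' Metric.closedBall 0 L) :=
    ((isCompact_closedBall 0 L).image OnePoint.continuous_coe).isClosed
  have e : {f : HolMap S | ∀ p, ∃ z : ℂ, f p = (z : OnePoint ℂ) ∧ ‖z‖ ≤ L} =
      ⋂ p, (fun f : HolMap S => f p) ⁻¹' (((↑) : ℂ → OnePoint ℂ) '' Metric.closedBall 0 L) := by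
    ext f
    simp only [mem_ofPred_eq, mem_iInter, mem_preimage, mem_image, mem_closedBall_zero_iff]
    exact forall_congr' fun p => exists_congr fun z => by rw [and_comm, eq_comm]
  rw [e]
  exact isClosed_iInter fun p => hc.preimage (continuous_eval p)

/-- The constant map with value `c`, which may be `∞`. -/
def const (S : Type u) [TopologicalSpace S] [ChartedSpace ℂ S] (c : OnePoint ℂ) : HolMap S :=
  ⟨fun _ => c, mdifferentiable_const⟩

theorem isNormalFamily_setOf_const :
    IsNormalFamily {f : HolMap S | ∃ c : OnePoint ℂ, ∀ p, f p = c} := by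
  intro f hf
  choose c hc using hf
  obtain ⟨a, k, hk, ha⟩ := CompactSpace.tendsto_subseq c
  refine ⟨k, hk, const S a, fun K hK ε hε => ?_⟩
  obtain ⟨N, hN⟩ := Metric.tendsto_atTop.mp ha ε hε
  refine ⟨N, fun n hn p _ => ?_⟩
  rw [hc]
  exact hN n hn

theorem isNormalFamily_setOf_norm_le [IsRiemannSurface S] (L : ℝ) :
    IsNormalFamily {f : HolMap S | ∀ p, ∃ z : ℂ, f p = (z : OnePoint ℂ) ∧ ‖z‖ ≤ L} := by
  intro f hf
  choose G hG hfG using fun n => (f n).exists_eq_coe fun p => (hf n p).imp fun _ h => h.1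
  have hL : ∀ n p, ‖G n p‖ ≤ L := fun n p => by
    obtain ⟨z, hz, hzL⟩ := hf n p
    rw [hfG n p, OnePoint.coe_eq_coe] at hz
    rwa [hz]
  obtain ⟨k, hk, g, hg, hlim⟩ := exists_subseq_tendsto_of_norm_le
    (G := fun n => ⟨G n, (hG n).continuous⟩) hG hL
  let ι : C(ℂ, OnePoint ℂ) := ⟨(↑), OnePoint.continuous_coe⟩
  have hlim' := ((ContinuousMap.continuous_postcomp (X := S) ι).tendsto g).comp hlim
  refine ⟨k, hk, ⟨fun p => (g p : OnePoint ℂ), mdifferentiable_coe.comp hg⟩,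
    fun K hK ε hε => ?_⟩
  obtain ⟨N, hN⟩ := exists_forall_chordalDist_lt_of_tendsto hlim' hK hε
  refine ⟨N, fun n hn p hp => ?_⟩
  rw [hfG]
  exact hN n hn p hp

theorem IsNormalFamily.mono {F F' : Set (HolMap S)} (hF' : IsNormalFamily F') (h : F ⊆ F') :
    IsNormalFamily F :=
  fun f hf => hF' f fun n => h (hf n)

/-- A sequence in a union of two families is infinitely often in one of them. -/
theorem IsNormalFamily.union {F F' : Set (HolMap S)} (hF : IsNormalFamily F)
    (hF' : IsNormalFamily F') : IsNormalFamily (F ∪ F') := by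
  have key : ∀ (f : ℕ → HolMap S) (A : Set (HolMap S)), IsNormalFamily A →
      (∃ᶠ n in atTop, f n ∈ A) → ∃ k : ℕ → ℕ, StrictMono k ∧ ∃ g : HolMap S, ∀ K : Set S,
        IsCompact K → ∀ ε > 0, ∃ N, ∀ n ≥ N, ∀ p ∈ K, chordalDist (f (k n) p) (g p) < ε := by
    intro f A hA hfA
    obtain ⟨j, hj, hjA⟩ := extraction_of_frequently_atTop hfA
    obtain ⟨k, hk, g, hg⟩ := hA (f ∘ j) hjA
    exact ⟨j ∘ k, hj.comp hk, g, hg⟩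
  intro f hf
  rcases frequently_or_distrib.mp (Frequently.of_forall (f := atTop) hf) with h | h
  · exact key f F hF h
  · exact key f F' hF' h

end HolMap

/-! ### Relatively compact domains -/

/-- Two points of a connected, locally connected, locally compact Hausdorff space lie in a common
relatively compact domain: the points that share such a domain with `p` form a clopen set. -/
theorem exists_relativelyCompact_domain {X : Type*} [TopologicalSpace X] [ConnectedSpace X]
    [T2Space X] [LocallyCompactSpace X] [LocallyConnectedSpace X] (p q : X) :
    ∃ U : Set X, IsOpen U ∧ IsConnected U ∧ IsCompact (closure U) ∧ p ∈ U ∧ q ∈ U := by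
  have nhd : ∀ x : X, ∃ U : Set X, IsOpen U ∧ IsConnected U ∧ IsCompact (closure U) ∧ x ∈ U := by
    intro x
    obtain ⟨K, hK, hxK⟩ := exists_compact_mem_nhds x
    obtain ⟨U, hUK, hUo, hxU, hUc⟩ :=
      locallyConnectedSpace_iff_subsets_isOpen_isConnected.mp ‹_› x K hxK
    exact ⟨U, hUo, hUc, hK.closure_of_subset hUK, hxU⟩
  have glue : ∀ {x y z : X}, (∃ U : Set X, IsOpen U ∧ IsConnected U ∧ IsCompact (closure U) ∧
      x ∈ U ∧ y ∈ U) → (∃ U : Set X, IsOpen U ∧ IsConnected U ∧ IsCompact (closure U) ∧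
      y ∈ U ∧ z ∈ U) → ∃ U : Set X, IsOpen U ∧ IsConnected U ∧ IsCompact (closure U) ∧
      x ∈ U ∧ z ∈ U := by
    rintro x y z ⟨U, hUo, hUc, hUk, hxU, hyU⟩ ⟨V, hVo, hVc, hVk, hyV, hzV⟩
    refine ⟨U ∪ V, hUo.union hVo, hUc.union ⟨y, hyU, hyV⟩ hVc, ?_, Or.inl hxU, Or.inr hzV⟩
    rw [closure_union]
    exact hUk.union hVk
  set R : Set X := {x | ∃ U : Set X, IsOpen U ∧ IsConnected U ∧ IsCompact (closure U) ∧
    p ∈ U ∧ x ∈ U} with hR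
  have hclopen : IsClopen R := by
    constructor
    · rw [← closure_subset_iff_isClosed]
      intro x hx
      obtain ⟨U, hUo, hUc, hUk, hxU⟩ := nhd x
      obtain ⟨y, hyU, hyR⟩ := mem_closure_iff.mp hx U hUo hxU
      exact glue hyR ⟨U, hUo, hUc, hUk, hyU, hxU⟩
    · rw [isOpen_iff_mem_nhds]
      rintro x ⟨U, hUo, hUc, hUk, hpU, hxU⟩
      exact mem_of_superset (hUo.mem_nhds hxU) fun y hy => ⟨U, hUo, hUc, hUk, hpU, hy⟩
  obtain ⟨U, hUo, hUc, hUk, hpU⟩ := nhd p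
  have : R = univ := hclopen.eq_univ ⟨p, U, hUo, hUc, hUk, hpU, hpU⟩
  exact this.ge (mem_univ q)

/-! ### The compact property of being bounded by `L` or constant -/

theorem proposition2p8 (L : ℝ) (hL : 0 < L) :
    IsCompactProperty.{u} (boundedOrConstant.{u} L) := by
  refine ⟨⟨?_, ?_, ?_⟩, ?_⟩
  · intro S T _ _ _ _ _ _ φ hφ _ f hf
    rcases hf with hf | ⟨c, hc⟩
    · exact Or.inl fun p => hf (φ p)
    · exact Or.inr ⟨c, fun p => hc (φ p)⟩
  · intro S _ _ _ f hf
    have : LocallyCompactSpace S := ChartedSpace.locallyCompactSpace ℂ S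
    have : LocallyConnectedSpace S := ChartedSpace.locallyConnectedSpace ℂ S
    obtain ⟨p⟩ := (inferInstance : Nonempty S)
    by_cases hc : ∀ q, f q = f p
    · exact Or.inr ⟨f p, hc⟩
    push Not at hc
    obtain ⟨q, hq⟩ := hc
    refine Or.inl fun r => ?_
    -- On a relatively compact domain through `p`, `q` and `r` the map is not constant, since
    -- `f q ≠ f p`; hence it is bounded by `L` there, in particular at `r`.
    obtain ⟨U, hUo, hUc, hUk, hpU, hqU⟩ := exists_relativelyCompact_domain p q
    obtain ⟨V, hVo, hVc, hVk, hpV, hrV⟩ := exists_relativelyCompact_domain p r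
    have hk : IsCompact (closure (U ∪ V)) := by
      rw [closure_union]
      exact hUk.union hVk
    rcases hf ⟨U ∪ V, hUo.union hVo⟩ (hUc.union ⟨p, hpU, hpV⟩ hVc) hk with h | ⟨c, h⟩
    · exact h ⟨r, Or.inr hrV⟩
    · exact absurd ((h ⟨q, Or.inl hqU⟩).trans (h ⟨p, Or.inl hpU⟩).symm) hq
  · intro S _ _ _
    rw [← closure_subset_iff_isClosed]
    have hsub : boundedOrConstant L S ⊆
        {f : HolMap S | ∀ p, ∃ z : ℂ, f p = (z : OnePoint ℂ) ∧ ‖z‖ ≤ L} ∪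
          {f : HolMap S | ∃ c : OnePoint ℂ, ∀ p, f p = c} :=
      union_subset_union_left _ fun f hf p => (hf p).imp fun _ h => ⟨h.1, h.2.le⟩
    refine (closure_minimal hsub
      ((HolMap.isClosed_setOf_norm_le L).union HolMap.isClosed_setOf_const)).trans ?_
    rintro f (hf | hf)
    · exact f.norm_lt_or_const_of_norm_le hf
    · exact Or.inr hf
  · intro S _ _ _
    exact ((HolMap.isNormalFamily_setOf_norm_le L).union HolMap.isNormalFamily_setOf_const).mono
      (union_subset_union_left _ fun f hf p => (hf p).imp fun _ h => ⟨h.1, h.2.le⟩)
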